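/- Let $G$ be a finite simple graph. A $b$-coloring of $G$ with $k$ colors is a proper vertex coloring using exactly $k$ colors in which every color class contains a vertex that has a neighbor in each of the other color classes. Let $S_b(G)$ be the set of integers $k$ such that $G$ has a $b$-coloring with $k$ colors, let $\chi(G)$ be the chromatic number of $G$, and let $b(G)=\max S_b(G)$. If $G$ has girth at least $8$ (that is, $G$ has no cycle of length less than $8$; in particular, $G$ may be acyclic), then $G$ is $b$-continuous, i.e. $S_b(G)=[\chi(G),b(G)]\cap\mathbb{Z}$: for every integer $k$ with $\chi(G)\le k\le b(G)$, $G$ has a $b$-coloring with exactly $k$ colors, and $G$ has no $b$-coloring with any other number of colors. -/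

import Mathlib

namespace SimpleGraph

variable {V : Type*} (G : SimpleGraph V)

/-- A vertex `u` is a b-vertex of the (proper) coloring `C` if it has a neighbor in every color
class other than its own. -/
def IsBVertex {k : ℕ} (C : G.Coloring (Fin k)) (u : V) : Prop :=
  ∀ j : Fin k, j ≠ C u → ∃ v, G.Adj u v ∧ C v = j

/-- A b-coloring with exactly `k` colors: a proper coloring with colors in `Fin k` in which every
one of the `k` color classes contains a b-vertex (so that all `k` colors are used). -/
def IsBColoring {k : ℕ} (C : G.Coloring (Fin k)) : Prop :=
  ∀ i : Fin k, ∃ u, C u = i ∧ G.IsBVertex C u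

/-- The b-spectrum: all `k` such that `G` has a b-coloring with exactly `k` colors. -/
def bSpectrum : Set ℕ :=
  {k | ∃ C : G.Coloring (Fin k), G.IsBColoring C}

/-- The b-chromatic number: the largest `k` such that `G` has a b-coloring with `k` colors
(for a finite graph the maximum exists, see `isGreatest_bChromaticNumber`). -/
noncomputable def bChromaticNumber : ℕ :=
  sSup G.bSpectrum

/-- `G` is b-continuous if its b-spectrum consists of all integers from the chromatic number
to the b-chromatic number. -/
def IsBContinuous : Prop :=
  G.bSpectrum = {k : ℕ | G.chromaticNumber ≤ (k : ℕ∞) ∧ k ≤ G.bChromaticNumber}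

theorem bSpectrum_bddAbove [Finite V] : BddAbove G.bSpectrum := by
  refine ⟨Nat.card V, ?_⟩
  rintro k ⟨C, hC⟩
  have hs : Function.Surjective C := fun i => (hC i).imp fun _ h => h.1
  simpa using Nat.card_le_card_of_surjective C hs

theorem bSpectrum_nonempty [Finite V] : G.bSpectrum.Nonempty := by
  classical
  have hex : ∃ n, G.Colorable n := by
    cases nonempty_fintype V
    exact ⟨_, G.colorable_of_fintype⟩
  obtain ⟨C⟩ := Nat.find_spec hex
  refine ⟨Nat.find hex, C, ?_⟩
  by_contra hb
  unfold IsBColoring IsBVertex at hb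
  push Not at hb
  obtain ⟨i, hi⟩ := hb
  choose f hf hfa using hi
  let D : V → {x : Fin (Nat.find hex) // x ≠ i} := fun v =>
    if h : C v = i then ⟨f v h, fun e => hf v h (e.trans h.symm)⟩ else ⟨C v, h⟩
  have hD : ∀ {u v : V}, G.Adj u v → D u ≠ D v := by
    intro u v huv hE
    have hne := C.valid huv
    by_cases hu : C u = i <;> by_cases hv : C v = i
    · exact hne (hu.trans hv.symm)
    · simp only [D, hu, hv, dite_true, dite_false, Subtype.mk.injEq] at hE
      exact hfa u hu v huv hE.symm
    · simp only [D, hu, hv, dite_true, dite_false, Subtype.mk.injEq] at hE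
      exact hfa v hv u huv.symm hE
    · simp only [D, hu, hv, dite_false, Subtype.mk.injEq] at hE
      exact hne hE
  have hcol := (Coloring.mk D hD).colorable
  have hle := Nat.find_min' hex hcol
  have hlt := Fintype.card_subtype_lt (p := fun x => x ≠ i) (x := i) (by simp)
  simp only [Fintype.card_fin] at hlt
  omega

theorem isGreatest_bChromaticNumber [Finite V] : IsGreatest G.bSpectrum G.bChromaticNumber :=
  ⟨Nat.sSup_mem G.bSpectrum_nonempty G.bSpectrum_bddAbove,
    fun _ hk => le_csSup G.bSpectrum_bddAbove hk⟩

end SimpleGraph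

namespace SimpleGraph

/-! ### Closed walks excluded by the girth -/

section ShortCycles

variable {V : Type*} {G : SimpleGraph V}

/-! Descend from `k + 1` to `k` colors. If some `k`-coloring is not a b-coloring, then `G` is `(k -
1)`-colorable. Erase one color class of a b-coloring with `k + 1` colors: each of the other `k`
colors keeps its b-vertices, so a partial b-coloring remains, and its uncolored vertices are treated
one at a time.

If some color has no b-vertex next to the uncolored vertex `x`, a local recoloring colors `x` and
uncolors nothing (`exists_extend`). Otherwise `x` sees b-vertices of all `k` colors, and a
b-coloring is built around `x` from a `(k - 1)`-coloring and one extra color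
(`mem_bSpectrum_of_center`). The girth keeps the local changes from interfering: each conflict would
close a cycle of length at most 7. -/

theorem false_of_closed_walk_three (hG : 8 ≤ G.egirth) {a b c : V}
    (hab : G.Adj a b) (hbc : G.Adj b c) (hca : G.Adj c a) : False := by
  have h := le_egirth.1 hG a (.cons hab (.cons hbc (.cons hca .nil)))
    (by simp [Walk.isCycle_def, Walk.isTrail_def, hab.ne, hbc.ne, hca.ne, hab.ne', hca.ne'])
  norm_num at h

theorem false_of_closed_walk_four (hG : 8 ≤ G.egirth) {a b c d : V}
    (hab : G.Adj a b) (hbc : G.Adj b c) (hcd : G.Adj c d) (hda : G.Adj d a)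
    (hac : a ≠ c) (hbd : b ≠ d) : False := by
  have h := le_egirth.1 hG a (.cons hab (.cons hbc (.cons hcd (.cons hda .nil))))
    (by simp [Walk.isCycle_def, Walk.isTrail_def, hab.ne, hbc.ne, hcd.ne, hda.ne, hab.ne',
      hda.ne', hac, hac.symm, hbd])
  norm_num at h

/-- No distinctness is assumed: if two vertices two steps apart coincide, a closed walk of length 3
remains. -/
theorem false_of_closed_walk_five (hG : 8 ≤ G.egirth) {a b c d e : V}
    (hab : G.Adj a b) (hbc : G.Adj b c) (hcd : G.Adj c d) (hde : G.Adj d e) (hea : G.Adj e a) :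
    False := by
  have hac : a ≠ c := by rintro rfl; exact false_of_closed_walk_three hG hcd hde hea
  have hbd : b ≠ d := by rintro rfl; exact false_of_closed_walk_three hG hde hea hab
  have hce : c ≠ e := by rintro rfl; exact false_of_closed_walk_three hG hea hab hbc
  have hda : d ≠ a := by rintro rfl; exact false_of_closed_walk_three hG hab hbc hcd
  have heb : e ≠ b := by rintro rfl; exact false_of_closed_walk_three hG hbc hcd hde
  have h := le_egirth.1 hG a (.cons hab (.cons hbc (.cons hcd (.cons hde (.cons hea .nil)))))
    (by simp [Walk.isCycle_def, Walk.isTrail_def, hab.ne, hbc.ne, hcd.ne, hde.ne, hea.ne, hab.ne',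
      hea.ne', hac, hac.symm, hbd, hce, hda,
      hda.symm, heb.symm])
  norm_num at h

theorem false_of_closed_walk_six (hG : 8 ≤ G.egirth) {a b c d e f : V}
    (hab : G.Adj a b) (hbc : G.Adj b c) (hcd : G.Adj c d) (hde : G.Adj d e) (hef : G.Adj e f)
    (hfa : G.Adj f a) (hac : a ≠ c) (hbd : b ≠ d) (hce : c ≠ e) (hdf : d ≠ f) (hea : e ≠ a)
    (hfb : f ≠ b) : False := by
  have had : a ≠ d := by rintro rfl; exact false_of_closed_walk_three hG hab hbc hcd
  have hbe : b ≠ e := by rintro rfl; exact false_of_closed_walk_three hG hbc hcd hde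
  have hcf : c ≠ f := by rintro rfl; exact false_of_closed_walk_three hG hcd hde hef
  have h := le_egirth.1 hG a
    (.cons hab (.cons hbc (.cons hcd (.cons hde (.cons hef (.cons hfa .nil))))))
    (by simp [Walk.isCycle_def, Walk.isTrail_def, hab.ne, hbc.ne, hcd.ne, hde.ne, hef.ne, hfa.ne,
      hab.ne', hfa.ne', hac, hac.symm, hbd, hce,
      hdf, hea, hea.symm, hfb.symm, had, had.symm, hbe, hcf,
      ])
  norm_num at h

theorem false_of_closed_walk_seven (hG : 8 ≤ G.egirth) {a b c d e f g : V}
    (hab : G.Adj a b) (hbc : G.Adj b c) (hcd : G.Adj c d) (hde : G.Adj d e) (hef : G.Adj e f)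
    (hfg : G.Adj f g) (hga : G.Adj g a) : False := by
  have hac : a ≠ c := by rintro rfl; exact false_of_closed_walk_five hG hcd hde hef hfg hga
  have hbd : b ≠ d := by rintro rfl; exact false_of_closed_walk_five hG hde hef hfg hga hab
  have hce : c ≠ e := by rintro rfl; exact false_of_closed_walk_five hG hef hfg hga hab hbc
  have hdf : d ≠ f := by rintro rfl; exact false_of_closed_walk_five hG hfg hga hab hbc hcd
  have heg : e ≠ g := by rintro rfl; exact false_of_closed_walk_five hG hga hab hbc hcd hde
  have hfa : f ≠ a := by rintro rfl; exact false_of_closed_walk_five hG hab hbc hcd hde hef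
  have hgb : g ≠ b := by rintro rfl; exact false_of_closed_walk_five hG hbc hcd hde hef hfg
  have had : a ≠ d := by rintro rfl; exact false_of_closed_walk_three hG hab hbc hcd
  have hbe : b ≠ e := by rintro rfl; exact false_of_closed_walk_three hG hbc hcd hde
  have hcf : c ≠ f := by rintro rfl; exact false_of_closed_walk_three hG hcd hde hef
  have hdg : d ≠ g := by rintro rfl; exact false_of_closed_walk_three hG hde hef hfg
  have hea : e ≠ a := by rintro rfl; exact false_of_closed_walk_three hG hef hfg hga
  have hfb : f ≠ b := by rintro rfl; exact false_of_closed_walk_three hG hfg hga hab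
  have hgc : g ≠ c := by rintro rfl; exact false_of_closed_walk_three hG hga hab hbc
  have h := le_egirth.1 hG a
    (.cons hab (.cons hbc (.cons hcd (.cons hde (.cons hef (.cons hfg (.cons hga .nil)))))))
    (by simp [Walk.isCycle_def, Walk.isTrail_def, hab.ne, hbc.ne, hcd.ne, hde.ne, hef.ne, hfg.ne,
      hga.ne, hab.ne', hga.ne', hac, hac.symm, hbd,
      hce, hdf, heg, hfa, hfa.symm, hgb.symm, had,
      had.symm, hbe, hcf, hdg, hea, hea.symm, hfb.symm,
      hgc.symm])
  norm_num at h

end ShortCycles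

/-! ### Recoloring and extending partial b-colorings -/

section PartialColorings

variable {V α : Type*}

/-- A partial coloring, with `none` for uncolored vertices, is proper if adjacent colored vertices
have different colors. -/
def IsPartialColoring (G : SimpleGraph V) (f : V → Option α) : Prop :=
  ∀ ⦃a b⦄, G.Adj a b → ∀ c, f a = some c → f b ≠ some c

/-- In the partial coloring `f`, the vertex `u` has color `i` and a neighbor in every other
color. -/
def IsPartialBVertex (G : SimpleGraph V) (f : V → Option α) (i : α) (u : V) : Prop :=
  f u = some i ∧ ∀ j, j ≠ i → ∃ v, G.Adj u v ∧ f v = some j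

/-- A partial coloring in which every color has a b-vertex. -/
def IsPartialBColoring (G : SimpleGraph V) (f : V → Option α) : Prop :=
  IsPartialColoring G f ∧ ∀ i, ∃ u, IsPartialBVertex G f i u

variable {G : SimpleGraph V} {f : V → Option α}

/-- Give color `j` to an independent set `R`, after moving the neighbors of `R` with color `j`
to colors missing in their neighborhoods. -/
theorem IsPartialColoring.exists_recolor (hf : IsPartialColoring G f) {j : α} {R : Set V}
    (hR : ∀ a ∈ R, ∀ b ∈ R, ¬ G.Adj a b) {g : V → α}
    (hg : ∀ v, f v = some j → (∃ r ∈ R, G.Adj r v) →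
      g v ≠ j ∧ ∀ u, G.Adj v u → f u ≠ some (g v)) :
    ∃ f' : V → Option α, IsPartialColoring G f' ∧ (∀ v ∈ R, f' v = some j) ∧
      (∀ v ∉ R, f v = some j → (∃ r ∈ R, G.Adj r v) → f' v = some (g v)) ∧
      (∀ v ∉ R, ¬ (f v = some j ∧ ∃ r ∈ R, G.Adj r v) → f' v = f v) := by
  classical
  let f' : V → Option α := fun v => if v ∈ R then some j else
    if f v = some j ∧ ∃ r ∈ R, G.Adj r v then some (g v) else f v
  have h₁ : ∀ v ∈ R, f' v = some j := fun v hv => by simp only [f', hv, if_true]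
  have h₂ : ∀ v ∉ R, f v = some j → (∃ r ∈ R, G.Adj r v) → f' v = some (g v) :=
    fun v hv hj hr => by simp only [f', hv, if_false, if_pos (And.intro hj hr)]
  have h₃ : ∀ v ∉ R, ¬ (f v = some j ∧ ∃ r ∈ R, G.Adj r v) → f' v = f v :=
    fun v hv hr => by simp only [f', hv, if_false, if_neg hr]
  refine ⟨f', ?_, h₁, h₂, h₃⟩
  have hRne : ∀ a ∈ R, ∀ b, G.Adj a b → f' b ≠ some j := by
    intro a ha b hab hb
    have hbR : b ∉ R := fun hbR => hR a ha b hbR hab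
    by_cases hbj : f b = some j
    · rw [h₂ b hbR hbj ⟨a, ha, hab⟩] at hb
      exact (hg b hbj ⟨a, ha, hab⟩).1 (Option.some.inj hb)
    · rw [h₃ b hbR fun h => hbj h.1] at hb
      exact hbj hb
  intro a b hab c ha hb
  by_cases haR : a ∈ R
  · rw [h₁ a haR] at ha
    exact hRne a haR b hab (hb.trans ha.symm)
  by_cases hbR : b ∈ R
  · rw [h₁ b hbR] at hb
    exact hRne b hbR a hab.symm (ha.trans hb.symm)
  -- Two moved vertices both had color `j`, so they are not adjacent; a moved vertex avoids all old
  -- colors around it.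
  by_cases haS : f a = some j ∧ ∃ r ∈ R, G.Adj r a <;>
    by_cases hbS : f b = some j ∧ ∃ r ∈ R, G.Adj r b
  · exact hf hab j haS.1 hbS.1
  · rw [h₂ a haR haS.1 haS.2] at ha
    rw [h₃ b hbR hbS, ← ha] at hb
    exact (hg a haS.1 haS.2).2 b hab hb
  · rw [h₂ b hbR hbS.1 hbS.2] at hb
    rw [h₃ a haR haS, ← hb] at ha
    exact (hg b hbS.1 hbS.2).2 a hab.symm ha
  · rw [h₃ a haR haS] at ha
    rw [h₃ b hbR hbS] at hb
    exact hf hab c ha hb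

/-- In a graph of girth at least 8, a partial b-coloring with an uncolored vertex `x` can be
extended to `x` after some recoloring, unless `x` has b-vertices of all colors as neighbors. -/
theorem IsPartialBColoring.exists_extend [Finite α] (hG : 8 ≤ G.egirth) (hf : IsPartialBColoring G f)
    {x : V} (hx : f x = none) {j₀ : α} (hj₀ : ∀ u, G.Adj x u → ¬ IsPartialBVertex G f j₀ u) :
    ∃ f' : V → Option α, IsPartialBColoring G f' ∧ f' x ≠ none ∧
      ∀ v, f' v = none → f v = none := by
  classical
  obtain ⟨hp, hr⟩ := hf
  by_contra hno
  have hmiss : ∀ j v, f v = some j → ¬ IsPartialBVertex G f j v →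
      ∃ c, c ≠ j ∧ ∀ u, G.Adj v u → f u ≠ some c := by
    intro j v hv hb
    by_contra! h
    exact hb ⟨hv, fun i hi => h i hi⟩
  choose! g hg using hmiss
  let bad : α → Prop := fun j => ∀ u, G.Adj x u → ¬ IsPartialBVertex G f j u
  -- Giving `x` a bad color `j` can only fail because some color `l` loses its b-vertices: each of
  -- them has all its `j`-neighbors next to `x`.
  have hdep : ∀ j, bad j → ∃ l, l ≠ j ∧
      ∀ u, IsPartialBVertex G f l u → ∀ v, G.Adj u v → f v = some j → G.Adj x v := by
    intro j hj
    by_contra! hl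
    apply hno
    obtain ⟨f', hp', h₁, h₂, h₃⟩ := hp.exists_recolor (j := j) (R := {x}) (by simp) (g := g j)
      (fun v hv ⟨r, hr, hrv⟩ => hg j v hv (hj v (by rwa [hr] at hrv)))
    simp only [Set.mem_singleton_iff, forall_eq, exists_eq_left] at h₁ h₂ h₃
    have hkeep : ∀ v i, f v = some i → ¬ (i = j ∧ G.Adj x v) → f' v = some i := by
      intro v i hv hn
      rw [h₃ v (by rintro rfl; simp [hx] at hv), hv]
      rintro ⟨h, h'⟩
      exact hn ⟨Option.some.inj (hv.symm.trans h), h'⟩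
    refine ⟨f', ⟨hp', fun i => ?_⟩, by simp [h₁], fun v hv => ?_⟩
    · by_cases hij : i = j
      · subst hij
        obtain ⟨u, hu⟩ := hr i
        refine ⟨u, hkeep u i hu.1 fun h => hj u h.2 hu, fun i' hi' => ?_⟩
        obtain ⟨v, huv, hv⟩ := hu.2 i' hi'
        exact ⟨v, huv, hkeep v i' hv fun h => hi' h.1⟩
      · obtain ⟨u, hu, v, huv, hv, hxv⟩ := hl i hij
        refine ⟨u, hkeep u i hu.1 fun h => hij h.1, fun i' hi' => ?_⟩
        by_cases hi'j : i' = j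
        · subst hi'j
          exact ⟨v, huv, hkeep v i' hv fun h => hxv h.2⟩
        · obtain ⟨v, huv, hv⟩ := hu.2 i' hi'
          exact ⟨v, huv, hkeep v i' hv fun h => hi'j h.1⟩
    · by_cases hvx : v = x
      · rw [hvx, hx]
      · by_contra hvn
        by_cases hS : f v = some j ∧ G.Adj x v
        · simp [h₂ v hvx hS.1 hS.2] at hv
        · exact hvn (by rw [← h₃ v hvx hS, hv])
  choose! l hlne hl using hdep
  have hlbad : ∀ j, bad j → bad (l j) := by
    intro j hj u hxu hu
    obtain ⟨v, huv, hv⟩ := hu.2 j (hlne j hj).symm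
    exact false_of_closed_walk_three hG hxu huv (hl j hj u hu v huv hv).symm
  have hlinj : ∀ j, bad j → ∀ j', bad j' → l j = l j' → j = j' := by
    intro j hj j' hj' hjj'
    by_contra hne
    obtain ⟨u, hu⟩ := hr (l j)
    obtain ⟨v, huv, hv⟩ := hu.2 j (hlne j hj).symm
    have hxv := hl j hj u hu v huv hv
    rw [hjj'] at hu
    obtain ⟨v', huv', hv'⟩ := hu.2 j' (hlne j' hj').symm
    have hxv' := hl j' hj' u hu v' huv' hv'
    refine false_of_closed_walk_four hG hxv huv.symm huv' hxv'.symm ?_ ?_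
    · rintro rfl; simp [hu.1] at hx
    · rintro rfl; exact hne (Option.some.inj (hv.symm.trans hv'))
  -- By finiteness `l` permutes the bad colors, so every b-vertex of a bad color is at distance 2
  -- from `x`.
  have hlsurj : ∀ m, bad m → ∃ j, bad j ∧ l j = m := by
    intro m hm
    have hinj : Function.Injective fun j : {j // bad j} => (⟨l j, hlbad j j.2⟩ : {j // bad j}) :=
      fun j j' h => Subtype.ext (hlinj j j.2 j' j'.2 (congrArg Subtype.val h))
    obtain ⟨j, hj⟩ := Finite.injective_iff_surjective.1 hinj ⟨m, hm⟩
    exact ⟨j, j.2, congrArg Subtype.val hj⟩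
  have hfar : ∀ m, bad m → ∀ u, IsPartialBVertex G f m u →
      ∃ j y, bad j ∧ l j = m ∧ f y = some j ∧ G.Adj x y ∧ G.Adj y u := by
    intro m hm u hu
    obtain ⟨j, hj, rfl⟩ := hlsurj m hm
    obtain ⟨y, huy, hy⟩ := hu.2 j (hlne j hj).symm
    exact ⟨j, y, hj, rfl, hy, hl j hj u hu y huy hy, huy.symm⟩
  -- The path `x, y, z, w` along which colors are moved.
  obtain ⟨j, hj⟩ : ∃ j, bad j := ⟨j₀, hj₀⟩
  obtain ⟨z, hz⟩ := hr (l j)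
  obtain ⟨y, hzy, hy⟩ := hz.2 j (hlne j hj).symm
  have hxy : G.Adj x y := hl j hj z hz y hzy hy
  have hyb := hg j y hy (hj y hxy)
  obtain ⟨w, hzw, hw⟩ := hz.2 (g j y) fun h => hyb.2 z hzy.symm (h ▸ hz.1)
  have hne : ∀ {a b i}, f a = some i → f b ≠ some i → a ≠ b := by
    rintro a _ i ha hb rfl; exact hb ha
  have hxne : ∀ {a i}, f a = some i → x ≠ a := by
    rintro _ i ha rfl; simp [hx] at ha
  have hxz : x ≠ z := hxne hz.1
  have hyw : y ≠ w := hne hy (by simp [hw, hyb.1])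
  have hxw : ¬ G.Adj x w := fun h =>
    false_of_closed_walk_four hG hxy hzy.symm hzw h.symm hxz hyw
  have hSb : ∀ v, f v = some j → (∃ r ∈ ({x, w} : Set V), G.Adj r v) →
      ¬ IsPartialBVertex G f j v := by
    rintro v hv ⟨r, rfl | rfl, hrv⟩ hvb
    · exact hj v hrv hvb
    · obtain ⟨j', y', hj', hlj', hy', hxy', hyv'⟩ := hfar j hj v hvb
      have hjj' : j' ≠ j := fun h => hlne j' hj' (by rw [hlj', h])
      refine false_of_closed_walk_six hG hxy hzy.symm hzw hrv hyv'.symm hxy'.symm hxz hyw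
        (hne hz.1 (by simp [hv, (hlne j hj).symm])) ?_ (hxne hv).symm
        (hne hy' (by simp [hy, hjj'.symm]))
      rintro rfl
      exact hxw hxy'
  -- Coloring `w` along with `x` saves `z`: `y` moves to the old color of `w`, and `w` replaces `y`
  -- as the `j`-neighbor of `z`.
  obtain ⟨f', hp', h₁, h₂, h₃⟩ := hp.exists_recolor (j := j) (R := {x, w}) (by
    rintro a (rfl | rfl) b (rfl | rfl)
    · exact G.irrefl
    · exact hxw
    · exact fun h => hxw h.symm
    · exact G.irrefl) (g := g j) (fun v hv hr => hg j v hv (hSb v hv hr))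
  simp only [Set.mem_insert_iff, Set.mem_singleton_iff, forall_eq_or_imp, forall_eq,
    exists_eq_or_imp, exists_eq_left, not_or] at h₁ h₂ h₃ hSb
  have hkeep : ∀ v i, f v = some i → v ≠ w → ¬ (i = j ∧ (G.Adj x v ∨ G.Adj w v)) →
      f' v = some i := by
    intro v i hv hvw hn
    rw [h₃ v ⟨(hxne hv).symm, hvw⟩, hv]
    rintro ⟨h, h'⟩
    exact hn ⟨Option.some.inj (hv.symm.trans h), h'⟩
  have hkeepB : ∀ u i, IsPartialBVertex G f i u → u ≠ w → ¬ G.Adj u w →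
      (∀ v, G.Adj u v → f v = some j → ¬ G.Adj x v ∧ ¬ G.Adj w v) →
      IsPartialBVertex G f' i u := by
    intro u i hu huw hauw hn
    refine ⟨hkeep u i hu.1 huw ?_, fun i' hi' => ?_⟩
    · rintro ⟨rfl, h⟩; exact hSb u hu.1 h hu
    · obtain ⟨v, huv, hv⟩ := hu.2 i' hi'
      refine ⟨v, huv, hkeep v i' hv (by rintro rfl; exact hauw huv) ?_⟩
      rintro ⟨rfl, h | h⟩
      · exact (hn v huv hv).1 h
      · exact (hn v huv hv).2 h
  refine hno ⟨f', ⟨hp', fun m => ?_⟩, by simp [h₁], fun v hv => ?_⟩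
  · by_cases hm : bad m
    · by_cases hml : m = l j
      · subst hml
        have hzw' : z ≠ w := hzw.ne
        refine ⟨z, hkeep z _ hz.1 hzw' fun h => hlne j hj h.1, fun i hi => ?_⟩
        by_cases hij : i = j
        · exact ⟨w, hzw, hij ▸ h₁.2⟩
        · by_cases hic : i = g j y
          · refine ⟨y, hzy, ?_⟩
            rw [h₂ y ⟨hxy.ne', hyw⟩ hy (Or.inl hxy), hic]
          · obtain ⟨v, hzv, hv⟩ := hz.2 i hi
            refine ⟨v, hzv, hkeep v i hv (hne hv ?_) fun h => hij h.1⟩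
            simpa [hw] using fun h => hic h.symm
      · obtain ⟨u, hu⟩ := hr m
        obtain ⟨j', y', hj', hlj', hy', hxy', hyu'⟩ := hfar m hm u hu
        have hjj' : j' ≠ j := fun h => hml (by rw [← hlj', h])
        refine ⟨u, hkeepB u m hu ?_ ?_ fun v huv hv => ⟨fun hxv => ?_, fun hwv => ?_⟩⟩
        · rintro rfl
          exact false_of_closed_walk_five hG hxy hzy.symm hzw hyu'.symm hxy'.symm
        · intro huw
          refine false_of_closed_walk_six hG hxy hzy.symm hzw huw.symm hyu'.symm hxy'.symm hxz hyw
            ?_ ?_ (hxne hu.1).symm (hne hy' (by simp [hy, hjj'.symm]))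
          · exact hne hz.1 (by simpa [hu.1] using hml)
          · rintro rfl; exact hxw hxy'
        · exact false_of_closed_walk_four hG hxy' hyu' huv hxv.symm (hxne hu.1)
            (hne hy' (by simp [hv, hjj'.symm]))
        · exact false_of_closed_walk_seven hG hxy hzy.symm hzw hwv huv.symm hyu'.symm hxy'.symm
    · simp only [bad, not_forall, not_not] at hm
      obtain ⟨u, hxu, hu⟩ := hm
      have hmj : m ≠ j := by rintro rfl; exact hj u hxu hu
      refine ⟨u, hkeepB u m hu ?_ ?_ fun v huv hv => ⟨fun hxv => ?_, fun hwv => ?_⟩⟩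
      · rintro rfl; exact hxw hxu
      · intro huw
        exact false_of_closed_walk_five hG hxy hzy.symm hzw huw.symm hxu.symm
      · exact false_of_closed_walk_three hG hxu huv hxv.symm
      · refine false_of_closed_walk_six hG hxy hzy.symm hzw hwv huv.symm hxu.symm hxz hyw
          ?_ ?_ (hxne hv).symm (hne hu.1 (by simp [hy, hmj.symm]))
        · exact hne hz.1 (by simp [hv, (hlne j hj).symm])
        · rintro rfl; exact hxw hxu
  · by_contra hvn
    have hvx : v ≠ x := by rintro rfl; simp [h₁.1] at hv
    have hvw : v ≠ w := by rintro rfl; simp [h₁.2] at hv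
    by_cases hS : f v = some j ∧ (G.Adj x v ∨ G.Adj w v)
    · simp [h₂ v ⟨hvx, hvw⟩ hS.1 hS.2] at hv
    · exact hvn (by rw [← h₃ v ⟨hvx, hvw⟩ hS, hv])

end PartialColorings

/-! ### Building a b-coloring around a center -/

/-- If an uncolored vertex has b-vertices of all colors as neighbors in a partial coloring with
`m + 1` colors, and the graph is `m`-colorable, then it has a b-coloring with `m + 1` colors. -/
theorem mem_bSpectrum_of_center {V : Type*} {G : SimpleGraph V} (hG : 8 ≤ G.egirth) {m : ℕ}
    (φ : G.Coloring (Fin m)) {f : V → Option (Fin (m + 1))} (hf : IsPartialColoring G f) {x : V}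
    (hx : f x = none) (h : ∀ j, ∃ u, G.Adj x u ∧ IsPartialBVertex G f j u) :
    m + 1 ∈ G.bSpectrum := by
  classical
  choose y' hxy' hy' using h
  let y : Fin m → V := fun j => y' j.succ
  have hxy : ∀ j, G.Adj x (y j) := fun j => hxy' _
  have hfy : ∀ j, f (y j) = some j.succ := fun j => (hy' _).1
  have hyb : ∀ j i : Fin m, i ≠ j → ∃ v, G.Adj (y j) v ∧ f v = some i.succ :=
    fun j i hij => (hy' _).2 _ (by simpa using hij)
  have hyinj : ∀ {i j}, i ≠ j → y i ≠ y j := by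
    intro i j hij h
    have := hfy i
    rw [h, hfy j] at this
    exact hij (by simpa using this.symm)
  -- Color `0` and uncolored both become `none`, which from here on is a genuine color: the extra
  -- one, with `x` as its b-vertex.
  let h : V → Option (Fin m) := fun v => (f v).bind (finSuccEquiv m)
  have hh : ∀ v i, h v = some i ↔ f v = some i.succ := by
    intro v i
    simp only [h, Option.bind_eq_some_iff]
    constructor
    · rintro ⟨a, ha, hai⟩
      rw [ha]
      induction a using Fin.cases with
      | zero => simp at hai
      | succ a => simpa using hai
    · intro hv
      exact ⟨_, hv, by simp⟩
  let T : Set V := {v | v ≠ x ∧ ∃ j, G.Adj (y j) v}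
  have hyT : ∀ j, y j ∉ T := by
    rintro j ⟨-, i, hi⟩
    exact false_of_closed_walk_three hG (hxy i) hi (hxy j).symm
  -- Old colors are kept on the `y j` and on `T`, so each `y j` stays a b-vertex. Elsewhere `φ` is
  -- used, with `none` where it clashes with `T`.
  let F : V → Option (Fin m) := fun v =>
    if v = x then none else if v ∈ T then h v else
    if hv : ∃ j, y j = v then some hv.choose else
    if ∃ t ∈ T, G.Adj t v ∧ h t = some (φ v) then none else some (φ v)
  have hFx : F x = none := by simp [F]
  have hFT : ∀ v ∈ T, F v = h v := fun v hv => by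
    simp only [F, if_neg hv.1, if_pos hv]
  have hFy : ∀ j, F (y j) = some j := fun j => by
    have hv : ∃ i, y i = y j := ⟨j, rfl⟩
    simp only [F, if_neg (hxy j).ne', if_neg (hyT j), dif_pos hv, Option.some.injEq]
    by_contra hne
    exact hyinj hne hv.choose_spec
  have hFnone : ∀ v, v ≠ x → v ∉ T → (∀ j, y j ≠ v) →
      (∃ t ∈ T, G.Adj t v ∧ h t = some (φ v)) → F v = none := fun v h₁ h₂ h₃ h₄ => by
    simp only [F, if_neg h₁, if_neg h₂, dif_neg (not_exists.2 h₃), if_pos h₄]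
  have hFsome : ∀ v, v ≠ x → v ∉ T → (∀ j, y j ≠ v) →
      (¬ ∃ t ∈ T, G.Adj t v ∧ h t = some (φ v)) → F v = some (φ v) := fun v h₁ h₂ h₃ h₄ => by
    simp only [F, if_neg h₁, if_neg h₂, dif_neg (not_exists.2 h₃), if_neg h₄]
  have hxvalid : ∀ b, G.Adj x b → F x ≠ F b := by
    intro b hxb hE
    rw [hFx] at hE
    by_cases hby : ∃ j, y j = b
    · obtain ⟨j, rfl⟩ := hby
      simp [hFy] at hE
    push Not at hby
    have hbT : b ∉ T := by
      rintro ⟨-, j, hj⟩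
      exact false_of_closed_walk_three hG (hxy j) hj hxb.symm
    by_cases hb : ∃ t ∈ T, G.Adj t b ∧ h t = some (φ b)
    · obtain ⟨t, ⟨htx, j, hj⟩, htb, -⟩ := hb
      exact false_of_closed_walk_four hG hxb htb.symm hj.symm (hxy j).symm htx.symm (hby j).symm
    · simp [hFsome b hxb.ne' hbT hby hb] at hE
  have hyvalid : ∀ j b, b ≠ x → G.Adj (y j) b → F (y j) ≠ F b := by
    intro j b hbx hjb hE
    rw [hFT b ⟨hbx, j, hjb⟩, hFy, eq_comm, hh] at hE
    exact hf hjb _ (hfy j) hE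
  have hTvalid : ∀ t ∈ T, ∀ b, b ≠ x → (∀ j, y j ≠ b) → G.Adj t b → F t ≠ F b := by
    rintro t ht b hbx hby htb hE
    obtain ⟨htx, i, hi⟩ := id ht
    by_cases hbT : b ∈ T
    · obtain ⟨-, j, hj⟩ := hbT
      exact false_of_closed_walk_five hG (hxy i) hi htb hj.symm (hxy j).symm
    · rw [hFT t ht] at hE
      by_cases hb : ∃ t ∈ T, G.Adj t b ∧ h t = some (φ b)
      · rw [hFnone b hbx hbT hby hb] at hE
        obtain ⟨t', ⟨htx', j, hj⟩, htb', ht'⟩ := hb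
        have htt' : t ≠ t' := by rintro rfl; simp [hE] at ht'
        by_cases hij : i = j
        · subst hij
          exact false_of_closed_walk_four hG hi htb htb'.symm hj.symm (hby i) htt'
        · exact false_of_closed_walk_six hG (hxy i) hi htb htb'.symm hj.symm (hxy j).symm
            htx.symm (hby i) htt' (hby j).symm htx' (hyinj hij).symm
      · rw [hFsome b hbx hbT hby hb] at hE
        exact hb ⟨t, ht, htb, hE⟩
  have hF : ∀ {a b}, G.Adj a b → F a ≠ F b := by
    intro a b hab
    by_cases hax : a = x
    · subst hax; exact hxvalid b hab
    by_cases hbx : b = x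
    · subst hbx; exact (hxvalid a hab.symm).symm
    by_cases hay : ∃ j, y j = a
    · obtain ⟨j, rfl⟩ := hay; exact hyvalid j b hbx hab
    by_cases hby : ∃ j, y j = b
    · obtain ⟨j, rfl⟩ := hby; exact (hyvalid j a hax hab.symm).symm
    push Not at hay hby
    by_cases haT : a ∈ T
    · exact hTvalid a haT b hbx hby hab
    by_cases hbT : b ∈ T
    · exact (hTvalid b hbT a hax hay hab.symm).symm
    by_cases ha : ∃ t ∈ T, G.Adj t a ∧ h t = some (φ a) <;>
      by_cases hb : ∃ t ∈ T, G.Adj t b ∧ h t = some (φ b)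
    · obtain ⟨t, ⟨-, i, hi⟩, hta, -⟩ := ha
      obtain ⟨t', ⟨-, j, hj⟩, htb, -⟩ := hb
      exact (false_of_closed_walk_seven hG (hxy i) hi hta hab htb.symm hj.symm (hxy j).symm).elim
    · simp [hFnone a hax haT hay ha, hFsome b hbx hbT hby hb]
    · simp [hFsome a hax haT hay ha, hFnone b hbx hbT hby hb]
    · simpa [hFsome a hax haT hay ha, hFsome b hbx hbT hby hb] using φ.valid hab
  let e := (finSuccEquiv m).symm
  refine ⟨Coloring.mk (fun v => e (F v)) fun hab h => hF hab (e.injective h), fun i => ?_⟩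
  obtain ⟨i, rfl⟩ := e.surjective i
  have hB : ∀ u, F u = i → (∀ j, j ≠ i → ∃ v, G.Adj u v ∧ F v = j) → ∃ u, e (F u) = e i ∧
      ∀ j, j ≠ e (F u) → ∃ v, G.Adj u v ∧ e (F v) = j := by
    intro u hu hn
    refine ⟨u, by rw [hu], fun j hj => ?_⟩
    obtain ⟨j, rfl⟩ := e.surjective j
    obtain ⟨v, huv, hv⟩ := hn j fun h => hj (by rw [h, hu])
    exact ⟨v, huv, by rw [hv]⟩
  cases i with
  | none =>
    refine hB x hFx fun j hj => ?_
    obtain ⟨j, rfl⟩ := Option.ne_none_iff_exists'.1 hj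
    exact ⟨y j, hxy j, hFy j⟩
  | some i =>
    refine hB (y i) (hFy i) fun j hj => ?_
    cases j with
    | none => exact ⟨x, (hxy i).symm, hFx⟩
    | some j =>
      obtain ⟨v, hyv, hv⟩ := hyb i j (by simpa using hj)
      refine ⟨v, hyv, ?_⟩
      rw [hFT v ⟨by rintro rfl; simp [hx] at hv, i, hyv⟩, hh]
      exact hv

/-! ### Descent by one color -/

/-- In a graph of girth at least 8 that is `m`-colorable, a partial b-coloring with `m + 1` colors
yields a b-coloring with `m + 1` colors. -/
theorem IsPartialBColoring.mem_bSpectrum {V : Type*} [Finite V] {G : SimpleGraph V}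
    (hG : 8 ≤ G.egirth) {m : ℕ} (hm : G.Colorable m) {f : V → Option (Fin (m + 1))}
    (hf : IsPartialBColoring G f) : m + 1 ∈ G.bSpectrum := by
  obtain ⟨φ⟩ := hm
  induction hn : {v | f v = none}.ncard using Nat.strong_induction_on generalizing f with
  | _ n ih =>
  by_cases htot : ∃ x, f x = none
  · obtain ⟨x, hx⟩ := htot
    by_cases hall : ∀ j, ∃ u, G.Adj x u ∧ IsPartialBVertex G f j u
    · exact mem_bSpectrum_of_center hG φ hf.1 hx hall
    · push Not at hall
      obtain ⟨j, hj⟩ := hall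
      obtain ⟨f', hf', hx', hle⟩ := hf.exists_extend hG hx hj
      refine ih _ (hn ▸ Set.ncard_lt_ncard ?_ (Set.toFinite _)) hf' rfl
      exact ⟨hle, fun hsub => hx' (hsub hx)⟩
  · push Not at htot
    choose C hC using fun v => Option.ne_none_iff_exists'.1 (htot v)
    refine ⟨Coloring.mk C fun {a b} hab h => hf.1 hab _ (hC a) (h ▸ hC b), fun i => ?_⟩
    obtain ⟨u, hu, hn⟩ := hf.2 i
    have hCu : C u = i := Option.some.inj ((hC u).symm.trans hu)
    refine ⟨u, hCu, fun j hj => ?_⟩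
    obtain ⟨v, huv, hv⟩ := hn j fun h => hj (h.trans hCu.symm)
    exact ⟨v, huv, Option.some.inj ((hC v).symm.trans hv)⟩

theorem mem_bSpectrum_of_succ_mem {V : Type*} [Finite V] {G : SimpleGraph V}
    (hG : 8 ≤ G.egirth) {m : ℕ} (hm : G.Colorable m) (h : m + 2 ∈ G.bSpectrum) :
    m + 1 ∈ G.bSpectrum := by
  obtain ⟨C, hC⟩ := h
  -- Color `0` is the one erased.
  let e := finSuccEquiv (m + 1)
  refine IsPartialBColoring.mem_bSpectrum hG hm (f := fun v => e (C v)) ⟨?_, fun i => ?_⟩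
  · intro a b hab c ha hb
    exact C.valid hab (e.injective (ha.trans hb.symm))
  · obtain ⟨u, hu, hn⟩ := hC (e.symm (some i))
    refine ⟨u, by simp [hu], fun j hj => ?_⟩
    obtain ⟨v, huv, hv⟩ := hn (e.symm (some j)) (by simpa [hu] using hj)
    exact ⟨v, huv, by simp [hv]⟩

/-- If a coloring is not a b-coloring, then one of its colors can be eliminated. -/
theorem exists_colorable_of_not_isBColoring {V : Type*} {G : SimpleGraph V} {k : ℕ}
    (C : G.Coloring (Fin k)) (hC : ¬ G.IsBColoring C) : ∃ m, k = m + 1 ∧ G.Colorable m := by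
  classical
  unfold IsBColoring IsBVertex at hC
  push Not at hC
  obtain ⟨i, hi⟩ := hC
  have : Nonempty (Fin k) := ⟨i⟩
  choose! g hg hgn using hi
  have hval : ∀ {a b}, G.Adj a b →
      (if C a = i then g a else C a) ≠ if C b = i then g b else C b := by
    intro a b hab hE
    have hne := C.valid hab
    by_cases ha : C a = i <;> by_cases hb : C b = i
    · exact hne (ha.trans hb.symm)
    · rw [if_pos ha, if_neg hb] at hE
      exact hgn a ha b hab hE.symm
    · rw [if_neg ha, if_pos hb] at hE
      exact hgn b hb a hab.symm hE
    · rw [if_neg ha, if_neg hb] at hE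
      exact hne hE
  have hcol : G.Colorable (Fintype.card {j : Fin k // j ≠ i}) :=
    (Coloring.mk (fun v => (⟨if C v = i then g v else C v, by
      split_ifs with h
      · exact h ▸ hg v h
      · exact h⟩ : {j : Fin k // j ≠ i})) fun hab hE =>
        hval hab (congrArg Subtype.val hE)).colorable
  obtain ⟨m, rfl⟩ : ∃ m, k = m + 1 := ⟨k - 1, by have := i.pos; omega⟩
  exact ⟨m, rfl, by simpa [Fintype.card_subtype_compl] using hcol⟩

end SimpleGraph

theorem theorem1 {V : Type*} [Finite V] (G : SimpleGraph V) (hG : 8 ≤ G.egirth) :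
    G.IsBContinuous := by
  ext k
  constructor
  · intro hk
    refine ⟨?_, G.isGreatest_bChromaticNumber.2 hk⟩
    obtain ⟨C, -⟩ := hk
    exact SimpleGraph.chromaticNumber_le_iff_colorable.2 ⟨C⟩
  · rintro ⟨hχ, hb⟩
    rw [SimpleGraph.chromaticNumber_le_iff_colorable] at hχ
    induction hb using Nat.decreasingInduction with
    | self => exact G.isGreatest_bChromaticNumber.1
    | of_succ k hk ih =>
      obtain ⟨C⟩ := id hχ
      by_cases hC : G.IsBColoring C
      · exact ⟨C, hC⟩
      -- The failure of `C` supplies the spare color: `G` is colorable with one color fewer than the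
      -- target.
      · obtain ⟨m, rfl, hm⟩ := SimpleGraph.exists_colorable_of_not_isBColoring C hC
        exact SimpleGraph.mem_bSpectrum_of_succ_mem hG hm (ih (hχ.mono (Nat.le_succ _)))
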